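/- Let $k$ be a field of characteristic $2$, let $G=\langle\sigma,\tau\rangle$ be the Klein four-group, and let $\chi=\{\langle\sigma\rangle,\langle\tau\rangle,\langle\sigma\tau\rangle\}$ be the set of its proper nontrivial subgroups. A surjective homomorphism of $kG$-modules is called $\chi$-split if it splits on restriction to every $H\in\chi$, and a $kG$-module $P$ is projective relative to $\chi$ if every homomorphism $P\to B$ lifts along every $\chi$-split surjection $A\to B$. Let $\cdots\to Q_1\to Q_0\to k\to 0$ be a relative projective resolution of the trivial module $k$, that is, an exact complex in which every $Q_n$ is projective relative to $\chi$ and every map is a $\chi$-split surjection onto the kernel of the next one. The relative cohomology $H^n_\chi(G,k)=\operatorname{Ext}^n_{kG,\chi}(k,k)$ is the $n$-th cohomology of the complex $\operatorname{Hom}_{kG}(Q_*,k)$. The cup product $H^i_\chi(G,k)\times H^j_\chi(G,k)\to H^{i+j}_\chi(G,k)$ sends the classes of cocycles $f\colon Q_i\to k$ and $g\colon Q_j\to k$ to the class of $f\circ F_i$, where $(F_n\colon Q_{j+n}\to Q_n)_{n\ge 0}$ is any chain map lifting $g$ (equivalently, to the class of $f\circ\Omega^i_\chi(g)$, where $f$,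 $g$ are regarded as homomorphisms on the syzygies $\Omega^i_\chi(k)$, $\Omega^j_\chi(k)$); it is extended bilinearly to $H^*_\chi(G,k)=\bigoplus_{n\ge0}H^n_\chi(G,k)$. If $\alpha_1,\alpha_2\in H^*_\chi(G,k)$ both have strictly positive degree, then $\alpha_1\smile\alpha_2=0$. -/

import Mathlib

open CategoryTheory CategoryTheory.Limits DirectSum

universe w u v

noncomputable section

/-- The set of proper nontrivial subgroups of a group. -/
def properNontrivialSubgroups (G : Type v) [Group G] : Set (Subgroup G) :=
  {H | H ≠ ⊥ ∧ H ≠ ⊤}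

section Relative

variable {k : Type u} [Field k] {G : Type v} [Group G]

/-- A surjective homomorphism of `kG`-modules that is `χ`-split, i.e. that splits on restriction to
every subgroup `H ∈ χ`. -/
def IsRelSplitEpi (χ : Set (Subgroup G)) {A B : Rep.{w} k G} (f : A ⟶ B) : Prop :=
  Epi f ∧ ∀ H ∈ χ, IsSplitEpi ((Rep.resFunctor H.subtype).map f)

/-- `P` is projective relative to `χ`: every homomorphism `P ⟶ B` lifts along every `χ`-split
surjective homomorphism `A ⟶ B`. -/
def IsRelProjective (χ : Set (Subgroup G)) (P : Rep.{w} k G) : Prop :=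
  ∀ ⦃A B : Rep.{w} k G⦄ (j : A ⟶ B) (φ : P ⟶ B), IsRelSplitEpi χ j → ∃ ψ : P ⟶ A, ψ ≫ j = φ

/-- A `χ`-relative projective resolution `… ⟶ Q₁ ⟶ Q₀ ⟶ M ⟶ 0`: each `Qₙ` is projective relative
to `χ`, and the complex is exact with all connecting homomorphisms splitting over every `H ∈ χ`,
i.e. each map is a `χ`-split surjection onto the kernel of the next one. -/
structure RelProjResolution (χ : Set (Subgroup G)) (M : Rep.{w} k G) where
  /-- the complex `… ⟶ Q₁ ⟶ Q₀` -/
  Q : ChainComplex (Rep.{w} k G) ℕ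
  /-- the augmentation `Q₀ ⟶ M` -/
  π : Q.X 0 ⟶ M
  relProjective : ∀ n, IsRelProjective χ (Q.X n)
  d_comp_π : Q.d 1 0 ≫ π = 0
  split_π : IsRelSplitEpi χ π
  split_zero : IsRelSplitEpi χ (kernel.lift π (Q.d 1 0) d_comp_π)
  split_succ : ∀ n, IsRelSplitEpi χ
    (kernel.lift (Q.d (n + 1) n) (Q.d (n + 2) (n + 1)) (Q.d_comp_d (n + 2) (n + 1) n))

namespace RelProjResolution

variable {χ : Set (Subgroup G)} {M : Rep.{w} k G} (P : RelProjResolution χ M)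

/-- The kernel of `Hom_{kG}(Qₙ, N) ⟶ Hom_{kG}(Qₙ₊₁, N)`. -/
def cocycles (N : Rep.{w} k G) (n : ℕ) : Submodule k (P.Q.X n ⟶ N) :=
  LinearMap.ker (Linear.leftComp k N (P.Q.d (n + 1) n))

/-- The image of `Hom_{kG}(Qₙ₋₁, N) ⟶ Hom_{kG}(Qₙ, N)`. It is zero for `n = 0`, because
`Q.d 0 (0 - 1) = 0`. -/
def coboundaries (N : Rep.{w} k G) (n : ℕ) : Submodule k (P.Q.X n ⟶ N) :=
  LinearMap.range (Linear.leftComp k N (P.Q.d n (n - 1)))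

/-- The relative Ext group `Extⁿ_{kG,χ}(M, N)`: the `n`-th cohomology of `Hom_{kG}(Q, N)`.
For `M = k` the trivial module, this is the relative cohomology group `Hⁿ_χ(G, N)`. -/
abbrev Ext (N : Rep.{w} k G) (n : ℕ) : Type _ :=
  P.cocycles N n ⧸ (P.coboundaries N n).submoduleOf (P.cocycles N n)

variable {P}

lemma mem_cocycles {N : Rep.{w} k G} {n : ℕ} {f : P.Q.X n ⟶ N} :
    f ∈ P.cocycles N n ↔ P.Q.d (n + 1) n ≫ f = 0 := Iff.rfl

lemma mem_coboundaries {N : Rep.{w} k G} {n : ℕ} {f : P.Q.X n ⟶ N} :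
    f ∈ P.coboundaries N n ↔ ∃ h, P.Q.d n (n - 1) ≫ h = f := Iff.rfl

variable (P)

/-- `F` is a chain map `Q[j] ⟶ Q` lifting `g : Qⱼ ⟶ M`. If `g` is a cocycle, then `g` amounts to a
homomorphism from the `j`-th syzygy `Ωʲ(M)` of the resolution to `M`, and the map from
`Ωʲ⁺ⁿ(M)` to `Ωⁿ(M)` induced by `F` is `Ωⁿ(g)`. -/
structure IsLift {j : ℕ} (g : P.Q.X j ⟶ M) (F : ∀ n, P.Q.X (j + n) ⟶ P.Q.X n) : Prop where
  zero : F 0 ≫ P.π = g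
  succ : ∀ n, F (n + 1) ≫ P.Q.d (n + 1) n = P.Q.d (j + n + 1) (j + n) ≫ F n

variable {P}

lemma lift_π {A : Rep.{w} k G} (hA : IsRelProjective χ A) (φ : A ⟶ M) : ∃ ψ, ψ ≫ P.π = φ :=
  hA _ φ P.split_π

lemma lift_zero {A : Rep.{w} k G} (hA : IsRelProjective χ A) (φ : A ⟶ P.Q.X 0)
    (h : φ ≫ P.π = 0) : ∃ ψ, ψ ≫ P.Q.d 1 0 = φ := by
  obtain ⟨ψ, hψ⟩ := hA _ (kernel.lift P.π φ h) P.split_zero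
  refine ⟨ψ, ?_⟩
  simpa using congrArg (fun x => x ≫ kernel.ι P.π) hψ

lemma lift_succ {A : Rep.{w} k G} (hA : IsRelProjective χ A) (n : ℕ) (φ : A ⟶ P.Q.X (n + 1))
    (h : φ ≫ P.Q.d (n + 1) n = 0) : ∃ ψ, ψ ≫ P.Q.d (n + 2) (n + 1) = φ := by
  obtain ⟨ψ, hψ⟩ := hA _ (kernel.lift _ φ h) (P.split_succ n)
  refine ⟨ψ, ?_⟩
  simpa using congrArg (fun x => x ≫ kernel.ι _) hψ

lemma exists_isLift {j : ℕ} {g : P.Q.X j ⟶ M} (hg : g ∈ P.cocycles M j) :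
    ∃ F, P.IsLift g F := by
  rw [mem_cocycles] at hg
  obtain ⟨F₀, h₀⟩ := P.lift_π (P.relProjective j) g
  obtain ⟨F₁, h₁⟩ := P.lift_zero (P.relProjective (j + 1)) (P.Q.d (j + 1) j ≫ F₀)
    (by rw [Category.assoc, h₀, hg])
  have step : ∀ (n : ℕ) (a : P.Q.X (j + n) ⟶ P.Q.X n) (b : P.Q.X (j + n + 1) ⟶ P.Q.X (n + 1)),
      b ≫ P.Q.d (n + 1) n = P.Q.d (j + n + 1) (j + n) ≫ a →
      ∃ c : P.Q.X (j + n + 2) ⟶ P.Q.X (n + 2),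
        c ≫ P.Q.d (n + 2) (n + 1) = P.Q.d (j + n + 2) (j + n + 1) ≫ b := fun n a b h =>
    P.lift_succ (P.relProjective _) n _ (by
      rw [Category.assoc, h, ← Category.assoc, P.Q.d_comp_d, zero_comp])
  choose c hc using step
  let S : ∀ n, {p : (P.Q.X (j + n) ⟶ P.Q.X n) × (P.Q.X (j + n + 1) ⟶ P.Q.X (n + 1)) //
      p.2 ≫ P.Q.d (n + 1) n = P.Q.d (j + n + 1) (j + n) ≫ p.1} := fun n =>
    Nat.rec ⟨(F₀, F₁), h₁⟩ (fun n p => ⟨(p.1.2, c n p.1.1 p.1.2 p.2), hc n p.1.1 p.1.2 p.2⟩) n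
  exact ⟨fun n => (S n).1.1, h₀, fun n => (S n).2⟩

lemma comp_mem_cocycles {N : Rep.{w} k G} {i j : ℕ} {f : P.Q.X i ⟶ N} {g : P.Q.X j ⟶ M}
    {F : ∀ n, P.Q.X (j + n) ⟶ P.Q.X n} (hf : f ∈ P.cocycles N i) (hF : P.IsLift g F) :
    F i ≫ f ∈ P.cocycles N (j + i) := by
  rw [mem_cocycles] at hf ⊢
  rw [← Category.assoc, ← hF.succ i, Category.assoc, hf, comp_zero]

lemma comp_mem_coboundaries_left {N : Rep.{w} k G} {i j : ℕ} {f : P.Q.X i ⟶ N} {g : P.Q.X j ⟶ M}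
    {F : ∀ n, P.Q.X (j + n) ⟶ P.Q.X n} (hf : f ∈ P.coboundaries N i) (hF : P.IsLift g F) :
    F i ≫ f ∈ P.coboundaries N (j + i) := by
  rw [mem_coboundaries] at hf ⊢
  obtain ⟨h, rfl⟩ := hf
  cases i with
  | zero => exact ⟨0, by simp⟩
  | succ i => exact ⟨F i ≫ h, by
      rw [← Category.assoc, ← Category.assoc]; exact congrArg (fun x => x ≫ h) (hF.succ i).symm⟩

lemma comp_mem_coboundaries_right {N : Rep.{w} k G} {i j : ℕ} {f : P.Q.X i ⟶ N} {g : P.Q.X j ⟶ M}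
    {F : ∀ n, P.Q.X (j + n) ⟶ P.Q.X n} (hf : f ∈ P.cocycles N i) (hg : g ∈ P.coboundaries M j)
    (hF : P.IsLift g F) : F i ≫ f ∈ P.coboundaries N (j + i) := by
  have key : ∀ n, ∃ (s : P.Q.X (j + n) ⟶ P.Q.X (n + 1)) (t : P.Q.X (j + n - 1) ⟶ P.Q.X n),
      F n = s ≫ P.Q.d (n + 1) n + P.Q.d (j + n) (j + n - 1) ≫ t := by
    intro n
    induction n with
    | zero =>
      obtain ⟨h, hh⟩ := mem_coboundaries.1 hg
      obtain ⟨t, ht⟩ := P.lift_π (P.relProjective (j - 1)) h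
      obtain ⟨s, hs⟩ := P.lift_zero (P.relProjective j) (F 0 - P.Q.d j (j - 1) ≫ t) (by
        rw [Preadditive.sub_comp, Category.assoc, ht, hh, sub_eq_zero]; exact hF.zero)
      exact ⟨s, t, by rw [hs]; exact (sub_add_cancel _ _).symm⟩
    | succ n ih =>
      obtain ⟨s, t, h⟩ := ih
      obtain ⟨s', hs'⟩ := P.lift_succ (P.relProjective (j + n + 1)) n
        (F (n + 1) - P.Q.d (j + n + 1) (j + n) ≫ s) (by
          rw [Preadditive.sub_comp]
          refine sub_eq_zero.2 ((hF.succ n).trans ?_)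
          rw [h, Preadditive.comp_add, ← Category.assoc (P.Q.d _ _) (P.Q.d _ _) t, P.Q.d_comp_d,
            zero_comp, add_zero, Category.assoc])
      exact ⟨s', s, by rw [hs']; exact (sub_add_cancel _ _).symm⟩
  obtain ⟨s, t, h⟩ := key i
  rw [mem_cocycles] at hf
  refine mem_coboundaries.2 ⟨t ≫ f, ?_⟩
  rw [h, Preadditive.add_comp, Category.assoc, hf, comp_zero, zero_add, Category.assoc]

variable (P)

/-- A chosen chain map lifting a cocycle; the products below do not depend on the choice. -/
def liftCocycle {j : ℕ} (g : P.cocycles M j) (n : ℕ) : P.Q.X (j + n) ⟶ P.Q.X n :=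
  (exists_isLift g.2).choose n

lemma isLift_liftCocycle {j : ℕ} (g : P.cocycles M j) : P.IsLift g.1 (P.liftCocycle g) :=
  (exists_isLift g.2).choose_spec

variable {P}

lemma mk_comp_eq {N : Rep.{w} k G} {i j : ℕ} {f : P.Q.X i ⟶ N} (hf : f ∈ P.cocycles N i)
    {g g' : P.Q.X j ⟶ M} {F F' : ∀ n, P.Q.X (j + n) ⟶ P.Q.X n}
    (hF : P.IsLift g F) (hF' : P.IsLift g' F') (h : g - g' ∈ P.coboundaries M j) :
    (Submodule.Quotient.mk ⟨F i ≫ f, comp_mem_cocycles hf hF⟩ : P.Ext N (j + i)) =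
      Submodule.Quotient.mk ⟨F' i ≫ f, comp_mem_cocycles hf hF'⟩ := by
  refine (Submodule.Quotient.eq _).2 ?_
  have h1 : P.IsLift (g - g') (fun n => F n - F' n) :=
    ⟨by rw [Preadditive.sub_comp, hF.zero, hF'.zero], fun n => by
      rw [Preadditive.sub_comp, hF.succ, hF'.succ, Preadditive.comp_sub]⟩
  have h2 := comp_mem_coboundaries_right hf h h1
  rw [Preadditive.sub_comp] at h2
  exact h2

variable (P)

/-- The product on cocycles: `f` and `g` go to the class of `f ∘ Ωⁱ(g)`. -/
def cupCocycles (N : Rep.{w} k G) (i j : ℕ) :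
    P.cocycles N i →ₗ[k] P.cocycles M j →ₗ[k] P.Ext N (j + i) :=
  LinearMap.mk₂ k
    (fun f g => Submodule.Quotient.mk
      ⟨P.liftCocycle g i ≫ f.1, comp_mem_cocycles f.2 (P.isLift_liftCocycle g)⟩)
    (fun f f' g => by
      rw [← Submodule.Quotient.mk_add]
      exact congrArg _ (Subtype.ext (Preadditive.comp_add _ _ _ _ _ _)))
    (fun c f g => by
      rw [← Submodule.Quotient.mk_smul]
      exact congrArg _ (Subtype.ext (Linear.comp_smul _ _ _ _ _ _)))
    (fun f g g' => by
      have h : P.IsLift (g + g').1 (fun n => P.liftCocycle g n + P.liftCocycle g' n) :=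
        ⟨by rw [Preadditive.add_comp, (P.isLift_liftCocycle g).zero,
            (P.isLift_liftCocycle g').zero]; rfl, fun n => by
          rw [Preadditive.add_comp, (P.isLift_liftCocycle g).succ,
            (P.isLift_liftCocycle g').succ, Preadditive.comp_add]⟩
      rw [mk_comp_eq f.2 (P.isLift_liftCocycle (g + g')) h (by rw [sub_self]; exact zero_mem _),
        ← Submodule.Quotient.mk_add]
      congr 1
      exact Subtype.ext (Preadditive.add_comp _ _ _ _ _ _))
    (fun c f g => by
      have h : P.IsLift (c • g).1 (fun n => c • P.liftCocycle g n) :=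
        ⟨by rw [Linear.smul_comp, (P.isLift_liftCocycle g).zero]; rfl, fun n => by
          rw [Linear.smul_comp, (P.isLift_liftCocycle g).succ, Linear.comp_smul]⟩
      rw [mk_comp_eq f.2 (P.isLift_liftCocycle (c • g)) h (by rw [sub_self]; exact zero_mem _),
        ← Submodule.Quotient.mk_smul]
      congr 1
      exact Subtype.ext (Linear.smul_comp _ _ _ _ _ _))

/-- The product `Extⁱ_{kG,χ}(M, N) × Extʲ_{kG,χ}(M, M) ⟶ Extⁱ⁺ʲ_{kG,χ}(M, N)`, sending the classes
of `f` and `g` to the class of `f ∘ Ωⁱ(g)`. For `M = N = k` it is the cup product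
`Hⁱ_χ(G, k) × Hʲ_χ(G, k) ⟶ Hⁱ⁺ʲ_χ(G, k)`. -/
def cup (N : Rep.{w} k G) (i j : ℕ) :
    P.Ext N i →ₗ[k] P.Ext M j →ₗ[k] P.Ext N (j + i) :=
  LinearMap.flip <| Submodule.liftQ _
    (LinearMap.flip <| Submodule.liftQ _ (P.cupCocycles N i j) (fun f hf => by
      refine LinearMap.ext fun g => ?_
      exact (Submodule.Quotient.mk_eq_zero _).2
        (comp_mem_coboundaries_left hf (P.isLift_liftCocycle g))))
    (fun g hg => by
      refine LinearMap.ext fun f => ?_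
      obtain ⟨f, rfl⟩ := Submodule.Quotient.mk_surjective _ f
      exact (Submodule.Quotient.mk_eq_zero _).2
        (comp_mem_coboundaries_right f.2 hg (P.isLift_liftCocycle g)))

/-- The product is computed by any chain map lifting `g`. -/
theorem cup_mk (N : Rep.{w} k G) (i j : ℕ) (f : P.cocycles N i) (g : P.cocycles M j)
    {F : ∀ n, P.Q.X (j + n) ⟶ P.Q.X n} (hF : P.IsLift g.1 F) :
    P.cup N i j (Submodule.Quotient.mk f) (Submodule.Quotient.mk g) =
      Submodule.Quotient.mk ⟨F i ≫ f.1, comp_mem_cocycles f.2 hF⟩ :=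
  mk_comp_eq f.2 (P.isLift_liftCocycle g) hF (by rw [sub_self]; exact zero_mem _)

/-- The graded module `Ext^*_{kG,χ}(M, M)`; for `M = k` it is `H^*_χ(G, k)`. -/
abbrev ExtStar : Type _ := ⨁ n, P.Ext M n

/-- The product of `Ext^*_{kG,χ}(M, M)`, the bilinear extension of `RelProjResolution.cup`;
for `M = k` it is the cup product of `H^*_χ(G, k)`. -/
def cupStar : P.ExtStar →ₗ[k] P.ExtStar →ₗ[k] P.ExtStar :=
  DirectSum.toModule k ℕ _ fun i => LinearMap.flip <| DirectSum.toModule k ℕ _ fun j =>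
    ((P.cup M i j).compr₂ (DirectSum.lof k ℕ (fun n => P.Ext M n) (j + i))).flip

theorem cupStar_lof (i j : ℕ) (α : P.Ext M i) (β : P.Ext M j) :
    P.cupStar (DirectSum.lof k ℕ (fun n => P.Ext M n) i α)
        (DirectSum.lof k ℕ (fun n => P.Ext M n) j β) =
      DirectSum.lof k ℕ (fun n => P.Ext M n) (j + i) (P.cup M i j α β) := by
  simp [cupStar]

end RelProjResolution

end Relative

section Existence

variable {k : Type u} [Field k] {G : Type u} [Group G] (χ : Set (Subgroup G))

/-- `⊕_{H ∈ χ} M↓_H↑^G`, which surjects onto `M` by a `χ`-split homomorphism. -/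
abbrev relCover (M : Rep.{u} k G) : Rep.{u} k G :=
  ∐ fun H : χ => (Rep.indFunctor k H.1.subtype).obj ((Rep.resFunctor H.1.subtype).obj M)

/-- The natural homomorphism `⊕_{H ∈ χ} M↓_H↑^G ⟶ M`. -/
abbrev relCoverπ (M : Rep.{u} k G) : relCover χ M ⟶ M :=
  Sigma.desc fun H : χ => (Rep.indResAdjunction k H.1.subtype).counit.app M

lemma relCover_relProjective (M : Rep.{u} k G) : IsRelProjective χ (relCover χ M) := by
  intro A B j φ hj
  have : ∀ H : χ, ∃ ψ : (Rep.indFunctor k H.1.subtype).obj ((Rep.resFunctor H.1.subtype).obj M) ⟶ A,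
      ψ ≫ j = Sigma.ι (fun H : χ => (Rep.indFunctor k H.1.subtype).obj
        ((Rep.resFunctor H.1.subtype).obj M)) H ≫ φ := by
    intro H
    have := hj.2 H H.2
    refine ⟨((Rep.indResAdjunction k H.1.subtype).homEquiv _ _).symm
      ((Rep.indResAdjunction k H.1.subtype).homEquiv _ _ (Sigma.ι (fun H : χ => (Rep.indFunctor k H.1.subtype).obj
        ((Rep.resFunctor H.1.subtype).obj M)) H ≫ φ) ≫ section_ ((Rep.resFunctor H.1.subtype).map j)), ?_⟩
    rw [← Adjunction.homEquiv_naturality_right_symm, Category.assoc, IsSplitEpi.id, Category.comp_id,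
      Equiv.symm_apply_apply]
  choose ψ hψ using this
  exact ⟨Sigma.desc ψ, Sigma.hom_ext _ _ fun H => by
    exact ((Category.assoc _ _ _).symm.trans (congrArg (fun x => x ≫ j) (Sigma.ι_desc ψ H))).trans (hψ H)⟩

lemma relCoverπ_split (hχ : χ.Nonempty) (M : Rep.{u} k G) : IsRelSplitEpi χ (relCoverπ χ M) := by
  have hs : ∀ H ∈ χ, IsSplitEpi ((Rep.resFunctor H.subtype).map (relCoverπ χ M)) := by
    intro H hH
    refine IsSplitEpi.mk' ⟨(Rep.indResAdjunction k H.subtype).unit.app _ ≫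
      (Rep.resFunctor H.subtype).map (Sigma.ι (fun H : χ => (Rep.indFunctor k H.1.subtype).obj
        ((Rep.resFunctor H.1.subtype).obj M)) ⟨H, hH⟩), ?_⟩
    refine Eq.trans ?_ ((Rep.indResAdjunction k H.subtype).right_triangle_components M)
    refine (Category.assoc _ _ _).trans (congrArg (_ ≫ ·) ?_)
    refine ((Rep.resFunctor H.subtype).map_comp _ _).symm.trans (congrArg _ ?_)
    exact Sigma.ι_desc (fun H : χ => (Rep.indResAdjunction k H.1.subtype).counit.app M) ⟨H, hH⟩
  obtain ⟨H, hH⟩ := hχ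
  have := hs H hH
  exact ⟨(Rep.resFunctor H.subtype).epi_of_epi_map inferInstance, hs⟩

set_option linter.unusedVariables false in
theorem relKey : ∀ {A B C D : Rep.{u} k G} (p : A ⟶ B) (hp : IsRelSplitEpi χ p) (q : C ⟶ D)
      (i : B ⟶ C) (hi : i ≫ q = 0) (hI : IsIso (kernel.lift q i hi)) (f : A ⟶ C) (hf : f = p ≫ i) (h : f ≫ q = 0),
      IsRelSplitEpi χ (kernel.lift q f h) := by
    intro A B C D p hp q i hi hI f hf h
    have e : kernel.lift q f h = p ≫ kernel.lift q i hi := by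
      apply equalizer.hom_ext; simp [hf]
    rw [e]
    have := hp.1
    refine ⟨epi_comp _ _, fun H hH => ?_⟩
    have := hp.2 H hH
    refine IsSplitEpi.mk' ⟨(Rep.resFunctor H.subtype).map (inv (kernel.lift q i hi)) ≫ section_ ((Rep.resFunctor H.subtype).map p), ?_⟩
    rw [Functor.map_comp, Category.assoc, IsSplitEpi.id_assoc, ← Functor.map_comp, IsIso.inv_hom_id]
    exact CategoryTheory.Functor.map_id _ _

set_option linter.unusedVariables false in
theorem relKey2 {A B C D E : Rep.{u} k G} (p : A ⟶ B) (hp : IsRelSplitEpi χ p) (q : C ⟶ D) (j : D ⟶ E) (hj : Mono j)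
    (e : B ≅ kernel q) (f : A ⟶ C) (hf : f = p ≫ e.hom ≫ kernel.ι q) (r : C ⟶ E) (hr : r = q ≫ j) (h : f ≫ r = 0) :
    IsRelSplitEpi χ (kernel.lift r f h) := by
  subst hr
  refine relKey χ p hp _ (e.hom ≫ kernel.ι q) (by simp) ?_ f hf h
  have : kernel.lift (q ≫ j) (e.hom ≫ kernel.ι q) (by simp) = e.hom ≫ (kernelCompMono q j).inv := by
    apply equalizer.hom_ext; simp
  rw [this]; infer_instance

/-- The iterated kernels of the homomorphisms `relCoverπ`. -/
def relΩ (M : Rep.{u} k G) : ℕ → Rep.{u} k G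
  | 0 => M
  | n + 1 => kernel (relCoverπ χ (relΩ M n))

/-- The differentials of the resolution built from `relCover`. -/
def relD (M : Rep.{u} k G) (n : ℕ) : relCover χ (relΩ χ M (n + 1)) ⟶ relCover χ (relΩ χ M n) :=
  relCoverπ χ (relΩ χ M (n + 1)) ≫ kernel.ι (relCoverπ χ (relΩ χ M n))

theorem relD_π (M : Rep.{u} k G) (n : ℕ) : relD χ M n ≫ relCoverπ χ (relΩ χ M n) = 0 :=
  (Category.assoc _ _ _).trans ((congrArg (_ ≫ ·) (kernel.condition _)).trans comp_zero)

theorem relD_sq (M : Rep.{u} k G) (n : ℕ) : relD χ M (n + 1) ≫ relD χ M n = 0 :=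
  (Category.assoc _ _ _).symm.trans ((congrArg (fun x => x ≫ _) (relD_π χ M (n+1))).trans zero_comp)

/-- Relative projective resolutions exist. -/
theorem nonempty_relProjResolution (hχ : χ.Nonempty) (M : Rep.{u} k G) :
    Nonempty (RelProjResolution χ M) := by
  refine ⟨{ Q := ChainComplex.of _ (relD χ M) (relD_sq χ M), π := relCoverπ χ M
            relProjective := fun n => relCover_relProjective χ (relΩ χ M n)
            d_comp_π := (congrArg (fun x => x ≫ relCoverπ χ M) (ChainComplex.of_d (fun n => relCover χ (relΩ χ M n)) (relD χ M) 0)).trans (relD_π χ M 0)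
            split_π := relCoverπ_split χ hχ M
            split_zero := ?_
            split_succ := ?_ }⟩
  · exact relKey2 χ (relCoverπ χ (relΩ χ M 1)) (relCoverπ_split χ hχ _) (relCoverπ χ M) (𝟙 M) inferInstance (Iso.refl _)
      _ ((ChainComplex.of_d (fun n => relCover χ (relΩ χ M n)) (relD χ M) 0).trans (congrArg _ (Category.id_comp _).symm)) _ (Category.comp_id _).symm _
  · intro n
    exact relKey2 χ (relCoverπ χ (relΩ χ M (n+2))) (relCoverπ_split χ hχ _) (relCoverπ χ (relΩ χ M (n+1))) (kernel.ι (relCoverπ χ (relΩ χ M n))) equalizer.ι_mono (Iso.refl _)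
      _ ((ChainComplex.of_d (fun n => relCover χ (relΩ χ M n)) (relD χ M) (n+1)).trans (congrArg _ (Category.id_comp _).symm)) _ (ChainComplex.of_d (fun n => relCover χ (relΩ χ M n)) (relD χ M) n) _

end Existence

end

/-! Let `s`, `t` generate `G`; signs play no role in characteristic 2. The product is killed by an
operator of degree -1. For an `s`-fixed `x` in `Q₀` with `π x = 1`, the map `ω p = π(p) (x + t x)`
is an endomorphism of `Q₀` that kills boundaries and has values in `ker π`, so it extends to a chain
map `W : Qₙ ⟶ Qₙ₊₁` (`exists_isShift_comp_eq_zero`). Up to a coboundary, a cocycle `g` of positive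
degree has a lift that factors through `W` in positive degrees, as `W` after a lift of a cocycle
`g'` of one degree more (`exists_shift`, `isLift_shift`). Hence `f ∘ Ω(g)` is cohomologous to `(f ∘
W) ∘ Ω(g')`, where `f ∘ W` has one degree less than `f`. Iterating brings `f` down to degree 1,
where `f ∘ W = 0` because `ω` takes values in `d((1 + t) Q₁)`.

The factorization exists once `g` vanishes on the fixed points of every nontrivial element: on a
relative projective module such a `g` is a functional composed with the norm `(1 + s)(1 + t)`. To
normalize `g` in this way (`exists_sub_coboundary_eq_zero`), one needs a homomorphism `e` such that
`e ∘ d` agrees with `g` on those fixed points. It is a sum of three functionals, one for each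
subgroup of order two, obtained by linear duality; the obstruction vanishes by `KernelCondition`,
which passes from each syzygy to the next (`KernelCondition.of_relExact`).

Both facts used about relative projectives, `exists_add_of_invariant` and `eq_zero_of_norm_eq_zero`,
are inherited by sums and retracts, so they are checked on `k[G/H] ⊗ V` by computing with pairs. -/

noncomputable section

namespace KleinFour

/-! ### Subgroups and generators of the Klein four-group. -/

section Group

variable {G : Type v} [Group G] [IsKleinFour G]

lemma index_eq_two {H : Subgroup G} (hH : H ∈ properNontrivialSubgroups G) : H.index = 2 := by
  have hc := H.card_mul_index
  rw [IsKleinFour.card_four (G := G)] at hc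
  have h1 : Nat.card H ≠ 1 := fun h => hH.1 (Subgroup.card_eq_one.1 h)
  have h2 : H.index ≠ 1 := fun h => hH.2 (Subgroup.index_eq_one.1 h)
  have h3 : H.index ∣ 4 := ⟨_, by rw [← hc, mul_comm]⟩
  have h4 : H.index ≤ 4 := Nat.le_of_dvd (by norm_num) h3
  interval_cases hi : H.index <;> omega

lemma zpowers_mem {s : G} (hs : s ≠ 1) : Subgroup.zpowers s ∈ properNontrivialSubgroups G := by
  refine ⟨by simpa using hs, fun h => IsKleinFour.not_isCyclic (G := G) ⟨s, fun x => ?_⟩⟩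
  exact Subgroup.mem_zpowers_iff.1 (h ▸ Subgroup.mem_top x)

lemma eq_one_or_eq_of_mem {H : Subgroup G} (hH : H.index = 2) {s t : G} (hs : s ≠ 1) (hsH : s ∈ H)
    (ht : t ∈ H) : t = 1 ∨ t = s := by
  by_contra! h
  have : H = ⊤ := by
    rw [eq_top_iff]
    intro x _
    by_cases hx : x = 1
    · exact hx ▸ H.one_mem
    by_cases hxs : x = s
    · exact hxs ▸ hsH
    by_cases hxt : x = t
    · exact hxt ▸ ht
    rw [IsKleinFour.eq_mul_of_ne_all hs h.1 h.2.symm hx hxs hxt]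
    exact H.mul_mem hsH ht
  rw [this, Subgroup.index_top] at hH
  omega

lemma nontrivial : Nontrivial G :=
  have := IsKleinFour.instFinite (G := G)
  (Finite.one_lt_card_iff_nontrivial (α := G)).1 (by rw [IsKleinFour.card_four]; norm_num)

omit [IsKleinFour G] in
lemma exists_notMem {H : Subgroup G} (hH : H.index = 2) : ∃ t, t ∉ H := by
  by_contra! h
  rw [(eq_top_iff.2 fun x _ => h x : H = ⊤), Subgroup.index_top] at hH
  omega

variable (G) in
lemma exists_generators : ∃ s t : G, s ≠ 1 ∧ t ≠ 1 ∧ s ≠ t := by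
  obtain ⟨s, hs⟩ := @exists_ne G nontrivial 1
  obtain ⟨t, ht⟩ := exists_notMem (index_eq_two (zpowers_mem hs))
  exact ⟨s, t, hs, fun h => ht (h ▸ Subgroup.one_mem _),
    fun h => ht (h ▸ Subgroup.mem_zpowers s)⟩

lemma eq_one_or_eq_of_mem_zpowers {s g : G} (hs : s ≠ 1) (hg : g ∈ Subgroup.zpowers s) :
    g = 1 ∨ g = s :=
  eq_one_or_eq_of_mem (index_eq_two (zpowers_mem hs)) hs (Subgroup.mem_zpowers s) hg

end Group

/-! ### Elementwise calculus in representations, in particular in characteristic 2. -/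

section Rep

variable {k : Type u} [Field k] {G : Type v} [Group G] {V W : Rep.{w} k G}

lemma map_ρ (f : V ⟶ W) (g : G) (x : V) : f.hom (V.ρ g x) = W.ρ g (f.hom x) :=
  Rep.hom_comm_apply f g x

lemma ρ_ρ (g h : G) (x : V) : V.ρ g (V.ρ h x) = V.ρ (g * h) x := by
  rw [map_mul]; rfl

/-- The morphism of representations given by an equivariant linear map. -/
def mkHom (f : V →ₗ[k] W) (hf : ∀ g x, f (V.ρ g x) = W.ρ g (f x)) : V ⟶ W :=
  Rep.ofHom ⟨f, fun g => LinearMap.ext (hf g)⟩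

lemma comp_hom_apply {U : Rep.{w} k G} (f : U ⟶ V) (g : V ⟶ W) (x : U) :
    (f ≫ g).hom x = g.hom (f.hom x) := rfl

lemma hom_ext_apply {f g : V ⟶ W} (h : ∀ x, f.hom x = g.hom x) : f = g := by
  ext x; exact h x

lemma sum_hom_apply {ι : Type*} (s : Finset ι) (f : ι → (V ⟶ W)) (x : V) :
    (∑ i ∈ s, f i).hom x = ∑ i ∈ s, (f i).hom x :=
  map_sum (AddMonoidHom.mk' (fun f : V ⟶ W => f.hom x) fun _ _ => rfl) f s

section Klein

variable [IsKleinFour G]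

/-- A linear map commuting with two generators of the Klein four-group is equivariant. -/
lemma equivariant_of_generators {s t : G} (hs : s ≠ 1) (ht : t ≠ 1) (hst : s ≠ t) {f : V →ₗ[k] W}
    (hfs : ∀ x, f (V.ρ s x) = W.ρ s (f x)) (hft : ∀ x, f (V.ρ t x) = W.ρ t (f x)) (g : G) (x : V) :
    f (V.ρ g x) = W.ρ g (f x) := by
  by_cases h1 : g = 1
  · simp [h1]
  by_cases h2 : g = s
  · rw [h2, hfs]
  by_cases h3 : g = t
  · rw [h3, hft]
  rw [IsKleinFour.eq_mul_of_ne_all hs ht hst h1 h2 h3, ← ρ_ρ, ← ρ_ρ, hfs, hft]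

@[simp] lemma ρ_self (g : G) (x : V) : V.ρ g (V.ρ g x) = x := by
  rw [ρ_ρ, IsKleinFour.mul_self]; simp

lemma ρ_comm (g h : G) (x : V) : V.ρ g (V.ρ h x) = V.ρ h (V.ρ g x) := by
  rw [ρ_ρ, ρ_ρ, mul_comm_of_exponent_two IsKleinFour.exponent_two]

end Klein

lemma add_self [CharP k 2] (x : V) : x + x = 0 := by
  have h : (2 : k) = 0 := CharTwo.two_eq_zero
  rw [← two_smul k, h, zero_smul]

lemma add_eq_zero_iff [CharP k 2] {x y : V} : x + y = 0 ↔ x = y := by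
  constructor
  · intro h
    rw [← sub_eq_zero, ← h, sub_eq_iff_eq_add, add_assoc, add_self, add_zero]
  · rintro rfl; exact add_self x

end Rep

/-! ### The modules `k[G/H] ⊗ V`. -/

section CosetTensor

variable {k : Type u} [Field k] {G : Type v} [Group G]

open Classical in
/-- The tensor product `k[G/H] ⊗ V` with the diagonal action, for a subgroup `H` of index two. It
is the representation induced from the restriction of `V` to `H`. -/
def cosetTensor (H : Subgroup G) (hH : H.index = 2) (V : Rep.{w} k G) : Rep.{w} k G :=
  Rep.of (X := V × V)
    { toFun g := if g ∈ H then (V.ρ g).prodMap (V.ρ g) else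
        (V.ρ g).prodMap (V.ρ g) ∘ₗ (LinearEquiv.prodComm k V V).toLinearMap
      map_one' := by
        rw [if_pos H.one_mem]
        ext <;> simp
      map_mul' g h := by
        have := Subgroup.mul_mem_iff_of_index_two hH (a := g) (b := h)
        by_cases hg : g ∈ H <;> by_cases hh : h ∈ H <;> simp only [hg, hh, this] <;>
          ext <;> simp }

variable {H : Subgroup G} (hH : H.index = 2) {V : Rep.{w} k G}

lemma cosetTensor_ρ_mem {g : G} (hg : g ∈ H) (a b : V) :
    (cosetTensor H hH V).ρ g (a, b) = (V.ρ g a, V.ρ g b) := by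
  have h : (cosetTensor H hH V).ρ g = (V.ρ g).prodMap (V.ρ g) := if_pos hg
  exact LinearMap.congr_fun h (a, b)

lemma cosetTensor_ρ_notMem {g : G} (hg : g ∉ H) (a b : V) :
    (cosetTensor H hH V).ρ g (a, b) = (V.ρ g b, V.ρ g a) := by
  have h : (cosetTensor H hH V).ρ g = (V.ρ g).prodMap (V.ρ g) ∘ₗ
    (LinearEquiv.prodComm k V V).toLinearMap := if_neg hg
  exact LinearMap.congr_fun h (a, b)

/-- The natural homomorphism `k[G/H] ⊗ V ⟶ V`. -/
def cosetTensorπ (V : Rep.{w} k G) : cosetTensor H hH V ⟶ V :=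
  mkHom (V := cosetTensor H hH V) (LinearMap.coprod LinearMap.id LinearMap.id) (by
    rintro g ⟨a, b⟩
    by_cases hg : g ∈ H
    · rw [cosetTensor_ρ_mem hH hg]; exact (map_add (V.ρ g) a b).symm
    · rw [cosetTensor_ρ_notMem hH hg]
      exact (add_comm _ _).trans (map_add (V.ρ g) a b).symm)

lemma cosetTensorπ_apply (a b : V) : (cosetTensorπ hH V).hom (a, b) = a + b := rfl

end CosetTensor

/-! ### Lifting elements and fixed points along relatively split maps. -/

section Exact

variable {k : Type u} [Field k] {G : Type v} [Group G] {A B C : Rep.{w} k G}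

lemma exists_apply_eq_of_epi_kernel_lift {f : A ⟶ B} {g : B ⟶ C} (h : f ≫ g = 0)
    (hf : Epi (kernel.lift g f h)) {b : B} (hb : g.hom b = 0) : ∃ a, f.hom a = b := by
  have h1 := (ShortComplex.exact_iff_epi_kernel_lift (ShortComplex.mk f g h)).2 hf
  have h2 := h1.map (forget₂ (Rep.{w} k G) (ModuleCat k))
  exact (ShortComplex.moduleCat_exact_iff _).1 h2 b hb

lemma exists_invariant_of_isRelSplitEpi {f : A ⟶ B} {χ : Set (Subgroup G)} (hf : IsRelSplitEpi χ f)
    {H : Subgroup G} (hH : H ∈ χ) {b : B} (hb : ∀ h ∈ H, B.ρ h b = b) :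
    ∃ a, f.hom a = b ∧ ∀ h ∈ H, A.ρ h a = a := by
  have := hf.2 H hH
  let s := section_ ((Rep.resFunctor H.subtype).map f)
  refine ⟨s.hom b, ?_, fun h hh => ?_⟩
  · exact congr(($(IsSplitEpi.id ((Rep.resFunctor H.subtype).map f))).hom b)
  · refine (map_ρ s ⟨h, hh⟩ b).symm.trans (congrArg s.hom (hb h hh))

/-- An `H`-equivariant section of the map onto the kernel carries `H`-fixed points to `H`-fixed
points. -/
lemma exists_invariant_of_isRelSplitEpi_kernel_lift {f : A ⟶ B} {g : B ⟶ C} (h : f ≫ g = 0)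
    {χ : Set (Subgroup G)} (hf : IsRelSplitEpi χ (kernel.lift g f h)) {H : Subgroup G}
    (hH : H ∈ χ) {b : B} (hb : g.hom b = 0) (hb' : ∀ h ∈ H, B.ρ h b = b) :
    ∃ a, f.hom a = b ∧ ∀ h ∈ H, A.ρ h a = a := by
  obtain ⟨a, rfl⟩ := exists_apply_eq_of_epi_kernel_lift h hf.1 hb
  have hι : Function.Injective (kernel.ι g).hom := (Rep.mono_iff_injective _).1 inferInstance
  have e : ∀ x, (kernel.ι g).hom ((kernel.lift g f h).hom x) = f.hom x := fun x => by
    rw [← comp_hom_apply, kernel.lift_ι]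
  obtain ⟨a', ha', hi⟩ := exists_invariant_of_isRelSplitEpi hf hH
    (b := (kernel.lift g f h).hom a) (fun x hx => hι (by rw [map_ρ, e, hb' x hx]))
  exact ⟨a', by rw [← e, ha', e], hi⟩

end Exact

/-! ### Relative projectives as retracts of sums of `k[G/H] ⊗ V`. -/

section RelProjective

variable {k : Type u} [Field k] {G : Type v} [Group G]

/-- The inclusion of `V` in `k[G/H] ⊗ V` as the component of the trivial coset. -/
def cosetTensorInl {H : Subgroup G} (hH : H.index = 2) (V : Rep.{w} k G) :
    V →ₗ[k] cosetTensor H hH V :=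
  LinearMap.inl k V V

lemma ρ_cosetTensorInl {H : Subgroup G} (hH : H.index = 2) {V : Rep.{w} k G} {h : G} (hh : h ∈ H)
    (a : V) : (cosetTensor H hH V).ρ h (cosetTensorInl hH V a) =
      cosetTensorInl hH V (V.ρ h a) :=
  (cosetTensor_ρ_mem hH hh a 0).trans (congrArg (Prod.mk (V.ρ h a)) (map_zero (V.ρ h)))

variable [IsKleinFour G]

instance : Finite (properNontrivialSubgroups G) :=
  have := IsKleinFour.instFinite (G := G)
  Subtype.finite

instance : HasFiniteBiproducts (Rep.{w} k G) := Abelian.hasFiniteBiproducts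

/-- The sum of the representations `k[G/H] ⊗ V`. -/
abbrev cosetCover (V : Rep.{w} k G) : Rep.{w} k G :=
  ⨁ fun H : properNontrivialSubgroups G => cosetTensor H.1 (index_eq_two H.2) V

/-- The inclusion of `k[G/H] ⊗ V` in the sum. -/
abbrev cosetCoverι (V : Rep.{w} k G) (H : properNontrivialSubgroups G) :
    cosetTensor H.1 (index_eq_two H.2) V ⟶ cosetCover V :=
  biproduct.ι (fun H : properNontrivialSubgroups G => cosetTensor H.1 (index_eq_two H.2) V) H

/-- The sum of the homomorphisms `k[G/H] ⊗ V ⟶ V`. -/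
def cosetCoverπ (V : Rep.{w} k G) : cosetCover V ⟶ V :=
  biproduct.desc fun H => cosetTensorπ (index_eq_two H.2) V

/-- Over `H`, the inclusion of the trivial coset component of the `H`-th summand is a section. -/
lemma isRelSplitEpi_cosetCoverπ (V : Rep.{w} k G) :
    IsRelSplitEpi (properNontrivialSubgroups G) (cosetCoverπ V) := by
  have key : ∀ (H : properNontrivialSubgroups G) (a : V), (cosetCoverπ V).hom
      ((cosetCoverι V H).hom (cosetTensorInl (index_eq_two H.2) V a)) = a := by
    intro H a
    rw [← comp_hom_apply, cosetCoverπ, biproduct.ι_desc]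
    exact (cosetTensorπ_apply (index_eq_two H.2) a 0).trans (add_zero a)
  constructor
  · obtain ⟨s, hs⟩ := @exists_ne G nontrivial 1
    exact (Rep.epi_iff_surjective _).2 fun a => ⟨_, key ⟨_, zpowers_mem hs⟩ a⟩
  · intro H hH
    refine IsSplitEpi.mk' ⟨mkHom (V := (Rep.resFunctor H.subtype).obj V)
      (W := (Rep.resFunctor H.subtype).obj (cosetCover V))
      ((cosetCoverι V ⟨H, hH⟩).hom.toLinearMap ∘ₗ
          cosetTensorInl (index_eq_two hH) V) ?_, ?_⟩
    · rintro ⟨h, hh⟩ x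
      exact (congrArg (cosetCoverι V ⟨H, hH⟩).hom
          (ρ_cosetTensorInl (index_eq_two hH) hh x).symm).trans (map_ρ _ h _)
    · exact hom_ext_apply (key ⟨H, hH⟩)

/-- A representation that is projective relative to `χ` is a retract of a sum of the `k[G/H] ⊗ V`. -/
lemma exists_retract {V : Rep.{w} k G} (hV : IsRelProjective (properNontrivialSubgroups G) V) :
    ∃ (_ : Fintype (properNontrivialSubgroups G))
      (p : ∀ H : properNontrivialSubgroups G, cosetTensor H.1 (index_eq_two H.2) V ⟶ V)
      (i : ∀ H : properNontrivialSubgroups G, V ⟶ cosetTensor H.1 (index_eq_two H.2) V),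
      ∀ x, ∑ H, (p H).hom ((i H).hom x) = x := by
  -- Lifting the identity splits the cover; the components of the splitting are the required maps.
  obtain ⟨ψ, hψ⟩ := hV _ (𝟙 V) (isRelSplitEpi_cosetCoverπ V)
  let _ := Fintype.ofFinite (properNontrivialSubgroups G)
  refine ⟨inferInstance, fun H => cosetCoverι V H ≫ cosetCoverπ V,
    fun H => ψ ≫ biproduct.π _ H, fun x => ?_⟩
  have h : ∑ H, (ψ ≫ biproduct.π _ H) ≫ cosetCoverι V H ≫ cosetCoverπ V = 𝟙 V := by
    have ht : ∑ H, biproduct.π _ H ≫ cosetCoverι V H = 𝟙 (cosetCover V) := by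
      refine biproduct.hom_ext' _ _ fun H => ?_
      rw [Preadditive.comp_sum, Finset.sum_eq_single H, biproduct.ι_π_self_assoc, Category.comp_id]
      · intro H' _ hH'
        rw [biproduct.ι_π_ne_assoc _ hH'.symm, zero_comp]
      · exact fun h => absurd (Finset.mem_univ H) h
    refine Eq.trans ?_ ((congrArg (ψ ≫ · ≫ cosetCoverπ V) ht).trans
      ((congrArg (ψ ≫ ·) (Category.id_comp _)).trans hψ))
    simp only [Preadditive.sum_comp, Preadditive.comp_sum, Category.assoc]
  exact (sum_hom_apply _ _ x).symm.trans congr(($h).hom x)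

end RelProjective

/-! ### Two elementwise properties of relative projectives. -/

section Elements

variable {k : Type u} [Field k] [CharP k 2] {G : Type v} [Group G] [IsKleinFour G]

/-- If `s ∈ H`, then `t` swaps the components, and the second component `(d)` of `c` gives `(a, b) =
(1 + s)(0, d) + (1 + t)(a, 0)`. If `s ∉ H`, a fixed pair is `(a, s a) = (1 + s)(a, 0)`. -/
lemma exists_add_of_invariant_cosetTensor {H : Subgroup G} (hH : H.index = 2) {V : Rep.{w} k G}
    {s t : G} (hs : s ≠ 1) (ht : t ≠ 1) (hst : s ≠ t) {a c : cosetTensor H hH V}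
    (ha : (cosetTensor H hH V).ρ s a = a)
    (hc : a + (cosetTensor H hH V).ρ t a = c + (cosetTensor H hH V).ρ s c) :
    ∃ p q, (cosetTensor H hH V).ρ s q = q ∧
      a = p + (cosetTensor H hH V).ρ s p + (q + (cosetTensor H hH V).ρ t q) := by
  obtain ⟨a, b⟩ := a
  obtain ⟨c, d⟩ := c
  by_cases hsH : s ∈ H
  · have htH : t ∉ H := fun h => by
      rcases eq_one_or_eq_of_mem hH hs hsH h with h | h
      exacts [ht h, hst h.symm]
    rw [cosetTensor_ρ_mem hH hsH] at ha
    rw [cosetTensor_ρ_notMem hH htH, cosetTensor_ρ_mem hH hsH] at hc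
    have ha1 : V.ρ s a = a := congrArg Prod.fst ha
    have hc2 : b + V.ρ t a = d + V.ρ s d := congrArg Prod.snd hc
    refine ⟨(0, d), (a, 0), ?_, ?_⟩
    · rw [cosetTensor_ρ_mem hH hsH]; exact Prod.ext ha1 (map_zero _)
    · rw [cosetTensor_ρ_mem hH hsH, cosetTensor_ρ_notMem hH htH]
      refine Prod.ext ?_ ?_
      · change a = 0 + V.ρ s 0 + (a + V.ρ t 0)
        simp
      · change b = d + V.ρ s d + (0 + V.ρ t a)
        rw [← hc2, zero_add, add_assoc, add_self, add_zero]
  · rw [cosetTensor_ρ_notMem hH hsH] at ha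
    have ha2 : V.ρ s a = b := congrArg Prod.snd ha
    refine ⟨(a, 0), 0, map_zero _, ?_⟩
    rw [map_zero, add_zero, add_zero, cosetTensor_ρ_notMem hH hsH]
    refine Prod.ext ?_ ?_
    · change a = a + V.ρ s 0
      simp
    · change b = 0 + V.ρ s a
      rw [ha2, zero_add]

lemma eq_zero_of_norm_eq_zero_cosetTensor {H : Subgroup G} (hH : H.index = 2) {V : Rep.{w} k G}
    {s t : G} (hs : s ≠ 1) (ht : t ≠ 1) (hst : s ≠ t) (φ : cosetTensor H hH V →ₗ[k] k)
    (hφ : ∀ g ≠ 1, ∀ a, (cosetTensor H hH V).ρ g a = a → φ a = 0) {a : cosetTensor H hH V}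
    (ha : a + (cosetTensor H hH V).ρ t a + (cosetTensor H hH V).ρ s
      (a + (cosetTensor H hH V).ρ t a) = 0) : φ a = 0 := by
  -- if `h ∈ H` and `r ∉ H` are both nontrivial and `(a, b)` is killed by the norm, then `(a, b)` is
  -- the sum of an element fixed by `r` and an element fixed by `h`
  have key : ∀ {h r : G}, h ≠ 1 → r ≠ 1 → h ∈ H → r ∉ H → ∀ a : cosetTensor H hH V,
      a + (cosetTensor H hH V).ρ r a + (cosetTensor H hH V).ρ h
        (a + (cosetTensor H hH V).ρ r a) = 0 → φ a = 0 := by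
    intro h r hh hr hhH hrH x ha
    rw [map_add] at ha
    obtain ⟨a, b⟩ := x
    rw [cosetTensor_ρ_notMem hH hrH, cosetTensor_ρ_mem hH hhH,
      cosetTensor_ρ_mem hH hhH] at ha
    have ha2 : b + V.ρ r a + (V.ρ h b + V.ρ h (V.ρ r a)) = 0 := congrArg Prod.snd ha
    rw [← map_add] at ha2
    have e : ((a, b) : cosetTensor H hH V) =
        ((a, V.ρ r a) : cosetTensor H hH V) + ((0, b + V.ρ r a) : cosetTensor H hH V) :=
      Prod.ext (add_zero a).symm (by
        change b = V.ρ r a + (b + V.ρ r a)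
        rw [add_left_comm, add_self, add_zero])
    have e1 := hφ r hr (a, V.ρ r a) (by rw [cosetTensor_ρ_notMem hH hrH, ρ_self])
    have e2 := hφ h hh (0, b + V.ρ r a) (by
      rw [cosetTensor_ρ_mem hH hhH, map_zero, ← add_eq_zero_iff.1 ha2])
    exact (congrArg φ e).trans ((map_add φ _ _).trans
      ((congrArg₂ (· + ·) e1 e2).trans (add_zero 0)))
  by_cases hsH : s ∈ H
  · have htH : t ∉ H := fun h => by
      rcases eq_one_or_eq_of_mem hH hs hsH h with h | h
      exacts [ht h, hst h.symm]
    exact key hs ht hsH htH a ha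
  by_cases htH : t ∈ H
  · refine key ht hs htH hsH a (Eq.trans ?_ ha)
    simp only [map_add]
    rw [ρ_comm s t]
    abel
  -- Since `H` has index two, it contains the product of two elements outside it; the generators `s
  -- * t` and `s` define the same norm.
  · have hstH : s * t ∈ H := by rw [Subgroup.mul_mem_iff_of_index_two hH]; tauto
    have hst1 : s * t ≠ 1 := fun h => hst (by
      rw [mul_eq_one_iff_eq_inv, IsKleinFour.inv_eq_self] at h; exact h)
    refine key hst1 hs hstH hsH a (Eq.trans ?_ ha)
    simp only [map_add]
    have e : ∀ x : cosetTensor H hH V, (cosetTensor H hH V).ρ s ((cosetTensor H hH V).ρ t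
        ((cosetTensor H hH V).ρ s x)) = (cosetTensor H hH V).ρ t x := fun x => by
      rw [ρ_comm t s, ρ_self]
    rw [← ρ_ρ, ← ρ_ρ, e]
    abel

variable {V : Rep.{w} k G} (hV : IsRelProjective (properNontrivialSubgroups G) V)
include hV

/-- This controls how far an `s`-fixed element of a relative projective is from being in the
radical; it drives the induction for `KernelCondition`. -/
lemma exists_add_of_invariant {s t : G} (hs : s ≠ 1) (ht : t ≠ 1) (hst : s ≠ t) {a c : V}
    (ha : V.ρ s a = a) (hc : a + V.ρ t a = c + V.ρ s c) :
    ∃ p q, V.ρ s q = q ∧ a = p + V.ρ s p + (q + V.ρ t q) := by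
  obtain ⟨_, π, ι, h⟩ := exists_retract hV
  have key : ∀ H, ∃ p q, V.ρ s q = q ∧
      (π H).hom ((ι H).hom a) = p + V.ρ s p + (q + V.ρ t q) := by
    intro H
    obtain ⟨p, q, hq, e⟩ := exists_add_of_invariant_cosetTensor (index_eq_two H.2) hs ht hst
      (a := (ι H).hom a) (c := (ι H).hom c) (by rw [← map_ρ, ha])
      (by rw [← map_ρ, ← map_ρ, ← map_add, hc, map_add])
    refine ⟨(π H).hom p, (π H).hom q, by rw [← map_ρ, hq], ?_⟩
    rw [e]
    simp only [map_add, map_ρ]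
  choose p q hq e using key
  refine ⟨∑ H, p H, ∑ H, q H, by simp only [map_sum, hq], ?_⟩
  rw [← h a]
  simp only [e, map_sum, Finset.sum_add_distrib]

lemma eq_zero_of_norm_eq_zero {s t : G} (hs : s ≠ 1) (ht : t ≠ 1) (hst : s ≠ t) (φ : V →ₗ[k] k)
    (hφ : ∀ g ≠ 1, ∀ a, V.ρ g a = a → φ a = 0) {a : V}
    (ha : a + V.ρ t a + V.ρ s (a + V.ρ t a) = 0) : φ a = 0 := by
  obtain ⟨_, π, ι, h⟩ := exists_retract hV
  rw [← h a, map_sum]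
  refine Finset.sum_eq_zero fun H _ => ?_
  refine eq_zero_of_norm_eq_zero_cosetTensor (index_eq_two H.2) hs ht hst
    (φ ∘ₗ (π H).hom.toLinearMap) (fun g hg b hb => hφ g hg _ ?_) (a := (ι H).hom a) ?_
  · exact (map_ρ (π H) g b).symm.trans (congrArg _ hb)
  · rw [← map_ρ, ← map_add, ← map_ρ, ← map_add, ha, map_zero]

end Elements

/-! ### Relative exactness and the radical of the syzygies. -/

section Exact

variable {k : Type u} [Field k] {G : Type v} [Group G] {A B C D : Rep.{u} k G}

/-- `A ⟶ B ⟶ C` is exact, and so is the sequence of invariants under each nontrivial element of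
`G`. -/
structure RelExact (f : A ⟶ B) (g : B ⟶ C) : Prop where
  zero : ∀ a, g.hom (f.hom a) = 0
  exact : ∀ b, g.hom b = 0 → ∃ a, f.hom a = b
  exact_invariant : ∀ s ≠ 1, ∀ b, B.ρ s b = b → g.hom b = 0 → ∃ a, f.hom a = b ∧ A.ρ s a = a

/-- An invariant element of the image of `f` is the image of an invariant element, for each
nontrivial element of `G`. -/
def InvariantLifting (f : A ⟶ B) : Prop :=
  ∀ s ≠ 1, ∀ a, B.ρ s (f.hom a) = f.hom a → ∃ r, f.hom r = f.hom a ∧ A.ρ s r = r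

/-- If `b` is an element of the kernel of `g` which is fixed by `s` and whose image under `1 + t` is
in the image of `1 + s` on the kernel, then `b` is in the radical of the kernel. -/
def KernelCondition (g : B ⟶ C) : Prop :=
  ∀ s ≠ 1, ∀ t ≠ 1, s ≠ t → ∀ b, g.hom b = 0 → B.ρ s b = b →
    (∃ c, g.hom c = 0 ∧ b + B.ρ t b = c + B.ρ s c) →
      ∃ c d, g.hom c = 0 ∧ g.hom d = 0 ∧ b = c + B.ρ s c + (d + B.ρ t d)

variable [IsKleinFour G]

lemma relExact_of_kernel_lift {f : A ⟶ B} {g : B ⟶ C} (h : f ≫ g = 0)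
    (hf : IsRelSplitEpi (properNontrivialSubgroups G) (kernel.lift g f h)) : RelExact f g where
  zero a := by rw [← comp_hom_apply, h]; rfl
  exact b hb := exists_apply_eq_of_epi_kernel_lift h hf.1 hb
  exact_invariant s hs b hb hb' := by
    obtain ⟨a, ha, ha'⟩ := exists_invariant_of_isRelSplitEpi_kernel_lift h hf (zpowers_mem hs) hb'
      (fun x hx => by
        rcases eq_one_or_eq_of_mem_zpowers hs hx with rfl | rfl
        · simp
        · exact hb)
    exact ⟨a, ha, ha' s (Subgroup.mem_zpowers s)⟩

omit [IsKleinFour G] in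
lemma RelExact.invariantLifting {f : A ⟶ B} {g : B ⟶ C} (h : RelExact f g) :
    InvariantLifting f :=
  fun s hs a ha => h.exact_invariant s hs _ ha (h.zero a)

lemma invariantLifting_of_isRelSplitEpi {f : A ⟶ B}
    (hf : IsRelSplitEpi (properNontrivialSubgroups G) f) : InvariantLifting f := by
  intro s hs a ha
  obtain ⟨r, hr, hr'⟩ := exists_invariant_of_isRelSplitEpi hf (zpowers_mem hs) (b := f.hom a)
    (fun x hx => by
      rcases eq_one_or_eq_of_mem_zpowers hs hx with rfl | rfl
      · simp
      · exact ha)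
  exact ⟨r, hr, hr' s (Subgroup.mem_zpowers s)⟩

variable [CharP k 2]

omit [IsKleinFour G] in
-- The image of `a` is `s`-fixed, so it lifts to an `s`-fixed `r`; adding `r` to `a` moves `a` into
-- the kernel without changing `(1 + s) a`.
lemma InvariantLifting.exists_kernel_add {f : A ⟶ B} (hf : InvariantLifting f) {s : G} (hs : s ≠ 1)
    {a : A} (ha : f.hom (a + A.ρ s a) = 0) :
    ∃ a', f.hom a' = 0 ∧ a' + A.ρ s a' = a + A.ρ s a := by
  rw [map_add, map_ρ, add_eq_zero_iff] at ha
  obtain ⟨r, hr, hr'⟩ := hf s hs a ha.symm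
  refine ⟨a + r, by rw [map_add, hr, add_self], ?_⟩
  rw [map_add, hr', add_add_add_comm, add_self, add_zero]

/-- Write `a = (1 + s) p + (1 + t) q` with `q` fixed by `s`. As `f a = 0`, the element `f q` of `ker
g` meets the hypothesis of the condition for `g`, so `f q = f((1 + s) x + (1 + t) y)`. Correcting
`q` by this preimage puts it in `ker f`; since `(1 + t)² = 0`, the change is absorbed by replacing
`p` with `p + (1 + t) x`, which is then moved into `ker f` by `exists_kernel_add`. -/
lemma KernelCondition.of_relExact {f : A ⟶ B} {g : B ⟶ C} (hg : KernelCondition g)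
    (hfg : RelExact f g) (hA : IsRelProjective (properNontrivialSubgroups G) A) :
    KernelCondition f := by
  have h2 : (2 : k) = 0 := CharTwo.two_eq_zero
  rintro s hs t ht hst a hfa hsa ⟨c, hfc, hc⟩
  obtain ⟨p, q, hq, e⟩ := exists_add_of_invariant hA hs ht hst hsa hc
  have h1 : f.hom q + B.ρ t (f.hom q) = f.hom p + B.ρ s (f.hom p) := by
    rw [← map_ρ, ← map_ρ, ← map_add, ← map_add, ← add_eq_zero_iff, ← map_add, add_comm, ← e, hfa]
  obtain ⟨x, y, hx, hy, exy⟩ := hg s hs t ht hst (f.hom q) (hfg.zero q) (by rw [← map_ρ, hq])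
    ⟨f.hom p, hfg.zero p, h1⟩
  obtain ⟨x, rfl⟩ := hfg.exact x hx
  obtain ⟨y, rfl⟩ := hfg.exact y hy
  have hκ : f.hom (q + (x + A.ρ s x + (y + A.ρ t y))) = 0 := by
    rw [map_add, exy]
    simp only [map_add, map_ρ]
    exact add_self _
  have ha : a = p + (x + A.ρ t x) + A.ρ s (p + (x + A.ρ t x)) +
      (q + (x + A.ρ s x + (y + A.ρ t y)) + A.ρ t (q + (x + A.ρ s x + (y + A.ρ t y)))) := by
    rw [e]
    simp only [map_add, ρ_self, ρ_comm t s]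
    -- The two sides differ by twice this sum.
    linear_combination (norm := module) -(h2 • (x + A.ρ s x + A.ρ t x + A.ρ s (A.ρ t x) + y + A.ρ t y))
  obtain ⟨a', ha', e'⟩ := hfg.invariantLifting.exists_kernel_add hs (a := p + (x + A.ρ t x)) (by
    have := hfa
    rw [ha, map_add, map_add f.hom (q + (x + A.ρ s x + (y + A.ρ t y))), map_ρ f t, hκ, map_zero,
      add_zero, add_zero] at this
    exact this)
  exact ⟨a', _, ha', hκ, by rw [e']; exact ha⟩

/-- The action on the target is trivial, so in `a = (1 + s) p + (1 + t) q` both `p` and `q` can be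
moved into the kernel, by elements fixed by `s` and by `t` respectively. -/
lemma kernelCondition_of_trivial {π : A ⟶ Rep.trivial k G k}
    (hπ : IsRelSplitEpi (properNontrivialSubgroups G) π)
    (hA : IsRelProjective (properNontrivialSubgroups G) A) : KernelCondition π := by
  have hl := invariantLifting_of_isRelSplitEpi hπ
  rintro s hs t ht hst a hfa hsa ⟨c, hfc, hc⟩
  obtain ⟨p, q, hq, e⟩ := exists_add_of_invariant hA hs ht hst hsa hc
  obtain ⟨r, hr, hr'⟩ := hl t ht q rfl
  obtain ⟨a', ha', e'⟩ := hl.exists_kernel_add hs (a := p) (by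
    rw [map_add, map_ρ]; exact add_self _)
  refine ⟨a', q + r, ha', by rw [map_add, hr, add_self], ?_⟩
  rw [e', e, map_add, hr', add_add_add_comm q r, add_self, add_zero]

/-! ### Homomorphisms to the trivial module and linear duality. -/

omit [IsKleinFour G] [CharP k 2] in
lemma apply_ρ_trivial (γ : A ⟶ Rep.trivial k G k) (g : G) (a : A) :
    γ.hom (A.ρ g a) = γ.hom a :=
  map_ρ γ g a

omit [IsKleinFour G] in
lemma apply_add_ρ_trivial (γ : A ⟶ Rep.trivial k G k) (g : G) (a : A) :
    γ.hom (a + A.ρ g a) = 0 := by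
  rw [map_add, map_ρ]
  exact add_self (γ.hom a)

omit [IsKleinFour G] in
-- The conditions prescribe `μ` on the image of `u : (a, b) ↦ (1 + t) f a + (1 + s) b`, so by
-- duality it is enough that `γ a = 0` whenever `u (a, b) = 0`. In that case `b` may be taken in
-- `ker g`, and `KernelCondition` puts `f a` in the radical of `ker g = im f`. So `a` lies in the
-- radical of `A` up to `ker f`, and `γ` kills both.
lemma exists_functional {f : A ⟶ B} {g : B ⟶ C} (hfg : RelExact f g) (hg : KernelCondition g)
    (hg' : InvariantLifting g) {γ : A ⟶ Rep.trivial k G k} (hγ : ∀ a, f.hom a = 0 → γ.hom a = 0)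
    {s t : G} (hs : s ≠ 1) (ht : t ≠ 1) (hst : s ≠ t) :
    ∃ μ : B →ₗ[k] k, (∀ b, μ (b + B.ρ s b) = 0) ∧
      ∀ a, B.ρ s (f.hom a) = f.hom a → μ (f.hom a + B.ρ t (f.hom a)) = γ.hom a := by
  let K : Submodule k A := LinearMap.ker ((B.ρ s - LinearMap.id) ∘ₗ f.hom.toLinearMap)
  have hK : ∀ a, a ∈ K ↔ B.ρ s (f.hom a) = f.hom a := fun a => sub_eq_zero
  let u : K × B →ₗ[k] B := LinearMap.coprod
    ((LinearMap.id + B.ρ t) ∘ₗ f.hom.toLinearMap ∘ₗ K.subtype) (LinearMap.id + B.ρ s)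
  have hu : ∀ a b, u (a, b) = f.hom a.1 + B.ρ t (f.hom a.1) + (b + B.ρ s b) := fun a b => rfl
  let l : Module.Dual k (K × B) := γ.hom.toLinearMap ∘ₗ K.subtype ∘ₗ LinearMap.fst k K B
  have hl : ∀ a b, l (a, b) = γ.hom a.1 := fun a b => rfl
  have hul : l ∈ (LinearMap.ker u).dualAnnihilator := by
    rw [Submodule.mem_dualAnnihilator]
    rintro ⟨⟨a, ha⟩, b⟩ hab
    rw [hK] at ha
    rw [LinearMap.mem_ker, hu] at hab
    rw [hl]
    have hab := add_eq_zero_iff.1 hab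
    obtain ⟨c, hc, e⟩ := hg'.exists_kernel_add hs (a := b) (by
      rw [← hab, map_add, map_ρ, hfg.zero, map_zero, add_zero])
    obtain ⟨x, y, hx, hy, e⟩ := hg s hs t ht hst _ (hfg.zero a) ha ⟨c, hc, by rw [e]; exact hab⟩
    obtain ⟨x, rfl⟩ := hfg.exact x hx
    obtain ⟨y, rfl⟩ := hfg.exact y hy
    have := hγ (a + (x + A.ρ s x + (y + A.ρ t y))) (by
      rw [map_add, e]
      simp only [map_add, map_ρ]
      exact add_self _)
    rwa [map_add, map_add, apply_add_ρ_trivial, apply_add_ρ_trivial, add_zero, add_zero] at this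
  rw [← LinearMap.range_dualMap_eq_dualAnnihilator_ker] at hul
  obtain ⟨μ, hμ⟩ := hul
  refine ⟨μ, fun b => ?_, fun a ha => ?_⟩
  · have := LinearMap.congr_fun hμ (0, b)
    simpa [hu, hl] using this
  · have := LinearMap.congr_fun hμ (⟨a, (hK a).2 ha⟩, 0)
    simpa [hu, hl] using this

/-- Each of the three functionals is invariant under one subgroup of order two, so its transfer to
`G` is a homomorphism. On the fixed points of a nontrivial element, the transfer from the subgroup
it generates gives `γ`, and the other two vanish. -/
lemma exists_hom_of_invariant {f : A ⟶ B} {g : B ⟶ C} (hfg : RelExact f g) (hg : KernelCondition g)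
    (hg' : InvariantLifting g) {γ : A ⟶ Rep.trivial k G k} (hγ : ∀ a, f.hom a = 0 → γ.hom a = 0) :
    ∃ e : B ⟶ Rep.trivial k G k, ∀ s ≠ 1, ∀ a, A.ρ s a = a → γ.hom a = e.hom (f.hom a) := by
  obtain ⟨s, t, hs, ht, hst⟩ := exists_generators G
  have hst1 : s * t ≠ 1 := fun h => hst (by
    rw [mul_eq_one_iff_eq_inv, IsKleinFour.inv_eq_self] at h; exact h)
  have hsts : s * t ≠ s := fun h => ht (mul_eq_left.1 h)
  obtain ⟨μ, hμ, hμ'⟩ := exists_functional hfg hg hg' hγ hs ht hst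
  obtain ⟨ν, hν, hν'⟩ := exists_functional hfg hg hg' hγ ht hs hst.symm
  obtain ⟨ξ, hξ, hξ'⟩ := exists_functional hfg hg hg' hγ hst1 hs hsts
  let e : B →ₗ[k] k := μ ∘ₗ (LinearMap.id + B.ρ t) + ν ∘ₗ (LinearMap.id + B.ρ s) +
    ξ ∘ₗ (LinearMap.id + B.ρ s)
  have he : ∀ b, e b = μ (b + B.ρ t b) + ν (b + B.ρ s b) + ξ (b + B.ρ s b) := fun b => rfl
  have eq_of : ∀ (η : B →ₗ[k] k) (g : G), (∀ b, η (b + B.ρ g b) = 0) → ∀ b, η (B.ρ g b) = η b :=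
    fun η g h b => by
      have := h b
      rw [map_add] at this
      exact (CharTwo.add_eq_zero.1 this).symm
  have hμs := eq_of μ s hμ
  have hνt := eq_of ν t hν
  have hξst := eq_of ξ (s * t) hξ
  refine ⟨mkHom (W := Rep.trivial k G k) e (equivariant_of_generators (W := Rep.trivial k G k)
    hs ht hst (fun b => ?_) (fun b => ?_)), fun r hr a ha => ?_⟩
  · change e (B.ρ s b) = e b
    rw [he, he, ρ_self, add_comm (B.ρ s b) b, ρ_comm t s, ← map_add (B.ρ s), hμs]
  · change e (B.ρ t b) = e b
    have h1 : ξ (B.ρ t b) = ξ (B.ρ s b) := by rw [← hξst (B.ρ t b), ← ρ_ρ, ρ_self]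
    have h2 : ξ (B.ρ s (B.ρ t b)) = ξ b := by rw [ρ_ρ, hξst]
    rw [he, he, ρ_self, add_comm (B.ρ t b) b, ρ_comm s t, ← map_add (B.ρ t), hνt,
      map_add (B.ρ t), map_add ξ, map_add ξ, h1, ρ_comm t s, h2, add_comm (ξ b)]
  · change γ.hom a = e (f.hom a)
    have hb : B.ρ r (f.hom a) = f.hom a := by rw [← map_ρ, ha]
    rw [he]
    by_cases h1 : r = s
    · subst h1
      rw [hb, add_self, map_zero, map_zero, add_zero, add_zero, hμ' a hb]
    by_cases h2 : r = t
    · subst h2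
      have h3 : B.ρ s (f.hom a) = B.ρ (s * r) (f.hom a) := by rw [← ρ_ρ, hb]
      rw [hb, add_self, map_zero, zero_add, hν' a hb, h3, hξ, add_zero]
    · have h3 := IsKleinFour.eq_mul_of_ne_all hs ht hst hr h1 h2
      subst h3
      have h3 : B.ρ t (f.hom a) = B.ρ s (f.hom a) := by
        nth_rw 1 [← hb]
        rw [← ρ_ρ, ρ_comm t s, ρ_self]
      have h4 := hν (f.hom a)
      rw [h3] at h4
      rw [h3, hμ, h4, zero_add, zero_add, hξ' a hb]

/-- By `eq_zero_of_norm_eq_zero`, `φ` vanishes on the kernel of the norm, so by duality it factors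
through the norm. -/
lemma exists_norm_functional (hA : IsRelProjective (properNontrivialSubgroups G) A)
    {s t : G} (hs : s ≠ 1) (ht : t ≠ 1) (hst : s ≠ t) (φ : A →ₗ[k] k)
    (hφ : ∀ g ≠ 1, ∀ a, A.ρ g a = a → φ a = 0) :
    ∃ m : A →ₗ[k] k, ∀ a, φ a = m (a + A.ρ t a + A.ρ s (a + A.ρ t a)) := by
  let N : A →ₗ[k] A := (LinearMap.id + A.ρ s) ∘ₗ (LinearMap.id + A.ρ t)
  have h : (φ : Module.Dual k A) ∈ (LinearMap.ker N).dualAnnihilator := by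
    rw [Submodule.mem_dualAnnihilator]
    exact fun a ha => eq_zero_of_norm_eq_zero hA hs ht hst φ hφ ha
  rw [← LinearMap.range_dualMap_eq_dualAnnihilator_ker] at h
  obtain ⟨m, hm⟩ := h
  exact ⟨m, fun a => (LinearMap.congr_fun hm a).symm⟩

end Exact

/-! ### Normalization of cocycles, the shift `W`, and vanishing of the product. -/

section Resolution

variable {k : Type u} [Field k] [CharP k 2] {G : Type v} [Group G] [IsKleinFour G]
  (P : RelProjResolution (properNontrivialSubgroups G) (Rep.trivial k G k))

include P in
omit [CharP k 2] in
lemma relExact_zero : RelExact (P.Q.d 1 0) P.π :=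
  relExact_of_kernel_lift P.d_comp_π P.split_zero

omit [CharP k 2] in
lemma relExact_succ (n : ℕ) : RelExact (P.Q.d (n + 2) (n + 1)) (P.Q.d (n + 1) n) :=
  relExact_of_kernel_lift (P.Q.d_comp_d (n + 2) (n + 1) n) (P.split_succ n)

lemma kernelCondition_d (n : ℕ) : KernelCondition (P.Q.d (n + 1) n) := by
  induction n with
  | zero =>
    exact (kernelCondition_of_trivial P.split_π (P.relProjective 0)).of_relExact
      (relExact_zero P) (P.relProjective 1)
  | succ n ih => exact ih.of_relExact (relExact_succ P n) (P.relProjective (n + 2))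

variable {P}

omit [CharP k 2] [IsKleinFour G] in
lemma cocycle_apply_d {n : ℕ} {f : P.Q.X n ⟶ Rep.trivial k G k}
    (hf : f ∈ P.cocycles (Rep.trivial k G k) n) (a : P.Q.X (n + 1)) :
    f.hom ((P.Q.d (n + 1) n).hom a) = 0 :=
  congr(($(RelProjResolution.mem_cocycles.1 hf)).hom a)

omit [CharP k 2] in
lemma cocycle_apply_eq_zero {n : ℕ} {f : P.Q.X (n + 1) ⟶ Rep.trivial k G k}
    (hf : f ∈ P.cocycles (Rep.trivial k G k) (n + 1)) {a : P.Q.X (n + 1)}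
    (ha : (P.Q.d (n + 1) n).hom a = 0) : f.hom a = 0 := by
  obtain ⟨b, rfl⟩ := (relExact_succ P n).exact a ha
  exact cocycle_apply_d hf b

/-- A cocycle of positive degree is cohomologous to one that vanishes on the invariants of each
nontrivial element. -/
lemma exists_sub_coboundary_eq_zero {j : ℕ} {g : P.Q.X (j + 1) ⟶ Rep.trivial k G k}
    (hg : g ∈ P.cocycles (Rep.trivial k G k) (j + 1)) :
    ∃ e : P.Q.X j ⟶ Rep.trivial k G k, ∀ s ≠ 1, ∀ a, (P.Q.X (j + 1)).ρ s a = a →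
      (g - P.Q.d (j + 1) j ≫ e).hom a = 0 := by
  have : ∃ e : P.Q.X j ⟶ Rep.trivial k G k, ∀ s ≠ 1, ∀ a, (P.Q.X (j + 1)).ρ s a = a →
      g.hom a = e.hom ((P.Q.d (j + 1) j).hom a) := by
    -- The map that follows the differential out of degree `j + 1` is `π` for `j = 0` and a
    -- differential otherwise; its own invariant lifting needs the same distinction one step further
    -- down.
    cases j with
    | zero =>
      exact exists_hom_of_invariant (relExact_zero P)
        (kernelCondition_of_trivial P.split_π (P.relProjective 0))
        (invariantLifting_of_isRelSplitEpi P.split_π) fun a => cocycle_apply_eq_zero hg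
    | succ j =>
      refine exists_hom_of_invariant (relExact_succ P j) (kernelCondition_d P j) ?_
        fun a => cocycle_apply_eq_zero hg
      cases j with
      | zero => exact (relExact_zero P).invariantLifting
      | succ j => exact (relExact_succ P j).invariantLifting
  obtain ⟨e, he⟩ := this
  exact ⟨e, fun s hs a ha => sub_eq_zero.2 (he s hs a ha)⟩

/-- `W` is a chain map `Q ⟶ Q[1]` that is given by `ω` in degree zero. -/
structure IsShift (ω : P.Q.X 0 ⟶ P.Q.X 0) (W : ∀ n, P.Q.X n ⟶ P.Q.X (n + 1)) : Prop where
  zero : W 0 ≫ P.Q.d 1 0 = ω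
  succ : ∀ n, W (n + 1) ≫ P.Q.d (n + 2) (n + 1) = P.Q.d (n + 1) n ≫ W n

omit [CharP k 2] [IsKleinFour G] in
-- The condition `h2` gives `W 0` and `h1` gives `W 1`; after that, the usual comparison argument
-- applies, carrying two consecutive maps at a time.
lemma exists_isShift {ω : P.Q.X 0 ⟶ P.Q.X 0} (h1 : P.Q.d 1 0 ≫ ω = 0) (h2 : ω ≫ P.π = 0) :
    ∃ W, IsShift ω W := by
  obtain ⟨W₀, hW₀⟩ := P.lift_zero (P.relProjective 0) ω h2
  obtain ⟨W₁, hW₁⟩ := P.lift_succ (P.relProjective 1) 0 (P.Q.d 1 0 ≫ W₀)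
    (by rw [Category.assoc, hW₀, h1])
  have step : ∀ (n : ℕ) (a : P.Q.X n ⟶ P.Q.X (n + 1)) (b : P.Q.X (n + 1) ⟶ P.Q.X (n + 2)),
      b ≫ P.Q.d (n + 2) (n + 1) = P.Q.d (n + 1) n ≫ a →
      ∃ c : P.Q.X (n + 2) ⟶ P.Q.X (n + 3),
        c ≫ P.Q.d (n + 3) (n + 2) = P.Q.d (n + 2) (n + 1) ≫ b := fun n a b h =>
    P.lift_succ (P.relProjective _) (n + 1) _ (by
      rw [Category.assoc, h, ← Category.assoc, P.Q.d_comp_d, zero_comp])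
  choose c hc using step
  let S : ∀ n, {p : (P.Q.X n ⟶ P.Q.X (n + 1)) × (P.Q.X (n + 1) ⟶ P.Q.X (n + 2)) //
      p.2 ≫ P.Q.d (n + 2) (n + 1) = P.Q.d (n + 1) n ≫ p.1} := fun n =>
    Nat.rec ⟨(W₀, W₁), hW₁⟩ (fun n p => ⟨(p.1.2, c n p.1.1 p.1.2 p.2), hc n p.1.1 p.1.2 p.2⟩) n
  exact ⟨fun n => (S n).1.1, hW₀, fun n => (S n).2⟩

omit [CharP k 2] [IsKleinFour G] in
lemma IsShift.comp_mem_cocycles {ω : P.Q.X 0 ⟶ P.Q.X 0} {W : ∀ n, P.Q.X n ⟶ P.Q.X (n + 1)}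
    (hW : IsShift ω W) {N : Rep.{u} k G} {i : ℕ} {f : P.Q.X (i + 1) ⟶ N}
    (hf : f ∈ P.cocycles N (i + 1)) : W i ≫ f ∈ P.cocycles N i := by
  rw [RelProjResolution.mem_cocycles] at hf ⊢
  rw [← Category.assoc, ← hW.succ, Category.assoc, hf, comp_zero]

omit [CharP k 2] [IsKleinFour G] in
lemma eqToHom_comp_mem_coboundaries {N : Rep.{u} k G} {m n : ℕ} (h : m = n) {f : P.Q.X n ⟶ N}
    (hf : f ∈ P.coboundaries N n) :
    eqToHom (congrArg P.Q.X h) ≫ f ∈ P.coboundaries N m := by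
  subst h
  simpa using hf

omit [CharP k 2] [IsKleinFour G] in
lemma eqToHom_comp_d {m n : ℕ} (h : m = n) :
    eqToHom (congrArg (fun n => P.Q.X (n + 1)) h) ≫ P.Q.d (n + 1) n =
      P.Q.d (m + 1) m ≫ eqToHom (congrArg P.Q.X h) := by
  subst h
  simp

omit [CharP k 2] [IsKleinFour G] in
lemma isLift_add {j : ℕ} {g g' h : P.Q.X j ⟶ Rep.trivial k G k}
    {F F' : ∀ n, P.Q.X (j + n) ⟶ P.Q.X n} (hF : P.IsLift g F) (hF' : P.IsLift g' F')
    (e : g + g' = h) : P.IsLift h (fun n => F n + F' n) where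
  zero := by rw [Preadditive.add_comp, hF.zero, hF'.zero, e]
  succ n := by rw [Preadditive.add_comp, hF.succ, hF'.succ, Preadditive.comp_add]

omit [CharP k 2] [IsKleinFour G] in
-- Above degree zero the lift of `g` is `W` after the lift of `g'`; `h` is the compatibility at the
-- junction. The `eqToHom` identifies degrees `j + (n + 1)` and `j + 1 + n`.
lemma isLift_shift {j : ℕ} {g : P.Q.X j ⟶ Rep.trivial k G k}
    {g' : P.Q.X (j + 1) ⟶ Rep.trivial k G k} {ω : P.Q.X 0 ⟶ P.Q.X 0}
    {W : ∀ n, P.Q.X n ⟶ P.Q.X (n + 1)} (hW : IsShift ω W)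
    {F : ∀ n, P.Q.X (j + 1 + n) ⟶ P.Q.X n} (hF : P.IsLift g' F) {F₀ : P.Q.X j ⟶ P.Q.X 0}
    (hF₀ : F₀ ≫ P.π = g) (h : F 0 ≫ ω = P.Q.d (j + 1) j ≫ F₀) :
    P.IsLift g (fun n => Nat.casesOn n F₀ fun n =>
      eqToHom (congrArg P.Q.X (Nat.succ_add_eq_add_succ j n).symm) ≫ F n ≫ W n) where
  zero := hF₀
  succ n := by
    cases n with
    | zero =>
      change (eqToHom _ ≫ F 0 ≫ W 0) ≫ P.Q.d 1 0 = P.Q.d (j + 1) j ≫ F₀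
      rw [← h, eqToHom_refl, Category.id_comp, Category.assoc, hW.zero]
    | succ n =>
      change (eqToHom _ ≫ F (n + 1) ≫ W (n + 1)) ≫ P.Q.d (n + 2) (n + 1) =
        P.Q.d (j + (n + 1) + 1) (j + (n + 1)) ≫ eqToHom _ ≫ F n ≫ W n
      rw [Category.assoc, Category.assoc, hW.succ, ← Category.assoc (F (n + 1)), hF.succ,
        Category.assoc]
      simp only [← Category.assoc]
      congr 2
      exact eqToHom_comp_d (Nat.succ_add_eq_add_succ j n).symm

/-- Choose a `t`-fixed `y` with `π y = π x`. Then `x + y = d q`, so `x + t x = d((1 + t) q)`. Hence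
`W 0 p` is a multiple of `(1 + t) q` modulo `ker d`, and a 1-cocycle with trivial coefficients
vanishes on both. -/
lemma exists_isShift_comp_eq_zero {s t : G} (hs : s ≠ 1) (ht : t ≠ 1) (hst : s ≠ t) {x : P.Q.X 0}
    (hx : (P.Q.X 0).ρ s x = x) :
    ∃ (ω : P.Q.X 0 ⟶ P.Q.X 0) (W : ∀ n, P.Q.X n ⟶ P.Q.X (n + 1)), IsShift ω W ∧
      (∀ p, ω.hom p = (P.π.hom p : k) • (x + (P.Q.X 0).ρ t x)) ∧
      ∀ f ∈ P.cocycles (Rep.trivial k G k) 1, W 0 ≫ f = 0 := by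
  obtain ⟨y, hy, hy'⟩ := invariantLifting_of_isRelSplitEpi P.split_π t ht x rfl
  obtain ⟨q, hq⟩ := (relExact_zero P).exact (x + y) (by
    rw [map_add, hy]; exact add_self _)
  have hq' : (P.Q.d 1 0).hom (q + (P.Q.X 1).ρ t q) = x + (P.Q.X 0).ρ t x := by
    rw [map_add, map_ρ, hq, map_add, hy', add_add_add_comm, add_self, add_zero]
  let ω' : P.Q.X 0 →ₗ[k] P.Q.X 0 :=
    LinearMap.smulRight (P.π.hom.toLinearMap : P.Q.X 0 →ₗ[k] k) (x + (P.Q.X 0).ρ t x)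
  have hω' : ∀ p, ω' p = (P.π.hom p : k) • (x + (P.Q.X 0).ρ t x) := fun p => rfl
  let ω : P.Q.X 0 ⟶ P.Q.X 0 := mkHom ω' (equivariant_of_generators hs ht hst
    (fun p => by rw [hω', hω', apply_ρ_trivial, map_smul, map_add, hx, ρ_comm s t, hx])
    (fun p => by
      rw [hω', hω', apply_ρ_trivial, map_smul, map_add, ρ_self, add_comm ((P.Q.X 0).ρ t x)]))
  obtain ⟨W, hW⟩ := exists_isShift (ω := ω)
    (hom_ext_apply fun a => by
      exact (hω' _).trans ((congrArg (· • _) ((relExact_zero P).zero a)).trans (zero_smul k _)))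
    (hom_ext_apply fun a => by
      refine (congrArg P.π.hom (hω' a)).trans ?_
      rw [map_smul, apply_add_ρ_trivial, smul_zero]
      rfl)
  refine ⟨ω, W, hW, hω', fun f hf => hom_ext_apply fun p => ?_⟩
  have h1 : (P.Q.d 1 0).hom ((W 0).hom p) = (P.π.hom p : k) • (x + (P.Q.X 0).ρ t x) :=
    congr(($(hW.zero)).hom p)
  have h2 := cocycle_apply_eq_zero hf
    (a := (W 0).hom p - (P.π.hom p : k) • (q + (P.Q.X 1).ρ t q)) (by
      rw [map_sub, map_smul, hq', h1, sub_self])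
  rw [map_sub, map_smul, apply_add_ρ_trivial, smul_zero, sub_zero] at h2
  exact h2

/-- A cocycle `g` of positive degree that vanishes on the invariants of each nontrivial element has
a lift which, up to the map `ω`, is induced by a cocycle in the next degree. -/
lemma exists_shift {s t : G} (hs : s ≠ 1) (ht : t ≠ 1) (hst : s ≠ t) {x : P.Q.X 0}
    (hx : (P.Q.X 0).ρ s x = x) (hπx : P.π.hom x = (1 : k)) {ω : P.Q.X 0 ⟶ P.Q.X 0}
    (hω : ∀ p, ω.hom p = (P.π.hom p : k) • (x + (P.Q.X 0).ρ t x)) {j : ℕ}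
    {g : P.Q.X j ⟶ Rep.trivial k G k} (hg : g ∈ P.cocycles (Rep.trivial k G k) j)
    (hg' : ∀ r ≠ 1, ∀ a, (P.Q.X j).ρ r a = a → g.hom a = 0) :
    ∃ g' ∈ P.cocycles (Rep.trivial k G k) (j + 1), ∃ F₀ : P.Q.X j ⟶ P.Q.X 0, F₀ ≫ P.π = g ∧
      ∀ F, P.IsLift g' F → F 0 ≫ ω = P.Q.d (j + 1) j ≫ F₀ := by
  obtain ⟨m, hm⟩ := exists_norm_functional (P.relProjective j) ht hs hst.symm g.hom.toLinearMap hg'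
  -- `n` is a half norm: it is `s`-invariant and `g = n + n ∘ t`.
  let n : P.Q.X j →ₗ[k] k := m ∘ₗ (LinearMap.id + (P.Q.X j).ρ s)
  have hn : ∀ a, n a = m (a + (P.Q.X j).ρ s a) := fun a => rfl
  have hns : ∀ a, n ((P.Q.X j).ρ s a) = n a := fun a => by
    rw [hn, hn, ρ_self, add_comm]
  have hgn : ∀ a, (g.hom a : k) = n a + n ((P.Q.X j).ρ t a) := fun a => by
    refine (hm a).trans ?_
    rw [hn, hn, ← map_add m, map_add ((P.Q.X j).ρ t), ρ_comm s t]
  have hnt : ∀ a, n ((P.Q.X j).ρ t a) = n a + (g.hom a : k) := fun a => by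
    rw [hgn, ← add_assoc, CharTwo.add_self_eq_zero, zero_add]
  -- This is `a ↦ n(a) x + n(t a) t x`, rewritten with `n(t a) = n(a) + g(a)`; it factors through
  -- `k[G/⟨s⟩]`. On boundaries `g` vanishes and only `n(a) (x + t x)` remains, which is the form of
  -- `ω`.
  let F' : P.Q.X j →ₗ[k] P.Q.X 0 := LinearMap.smulRight n (x + (P.Q.X 0).ρ t x) +
    LinearMap.smulRight (g.hom.toLinearMap : P.Q.X j →ₗ[k] k) ((P.Q.X 0).ρ t x)
  have hF' : ∀ a, F' a = n a • (x + (P.Q.X 0).ρ t x) + (g.hom a : k) • (P.Q.X 0).ρ t x :=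
    fun a => rfl
  have h2 : (2 : k) = 0 := CharTwo.two_eq_zero
  let F₀ : P.Q.X j ⟶ P.Q.X 0 := mkHom F' (equivariant_of_generators hs ht hst
    (fun a => by
      rw [hF', hF', hns, apply_ρ_trivial]
      simp only [map_add, map_smul, ρ_comm s t, hx])
    (fun a => by
      rw [hF', hF', hnt, apply_ρ_trivial]
      simp only [map_add, map_smul, ρ_self]
      linear_combination (norm := module) h2 • ((g.hom a : k) • (P.Q.X 0).ρ t x)))
  -- On boundaries `n` is also `t`-invariant, since `g` vanishes there; hence `n ∘ d` is
  -- equivariant.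
  let g' : P.Q.X (j + 1) ⟶ Rep.trivial k G k := mkHom (W := Rep.trivial k G k)
    (n ∘ₗ (P.Q.d (j + 1) j).hom.toLinearMap) (equivariant_of_generators (W := Rep.trivial k G k)
      hs ht hst
      (fun a => by
        change n ((P.Q.d (j + 1) j).hom _) = n ((P.Q.d (j + 1) j).hom a)
        rw [map_ρ, hns])
      (fun a => by
        change n ((P.Q.d (j + 1) j).hom _) = n ((P.Q.d (j + 1) j).hom a)
        rw [map_ρ, hnt, cocycle_apply_d hg]
        exact add_zero _))
  have hg' : ∀ a, (g'.hom a : k) = n ((P.Q.d (j + 1) j).hom a) := fun a => rfl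
  refine ⟨g', ?_, F₀, ?_, fun F hF => hom_ext_apply fun a => ?_⟩
  · rw [RelProjResolution.mem_cocycles]
    exact hom_ext_apply fun a => (hg' _).trans
      ((congrArg n ((relExact_succ P j).zero a)).trans (map_zero n))
  · refine hom_ext_apply fun a => (congrArg P.π.hom (hF' a)).trans ?_
    rw [map_add, map_smul, map_smul, apply_add_ρ_trivial, apply_ρ_trivial, hπx, smul_zero, zero_add]
    exact mul_one (g.hom a : k)
  · refine (hω _).trans (Eq.trans ?_ (hF' _).symm)
    have h3 : (P.π.hom ((F 0).hom a) : k) = n ((P.Q.d (j + 1) j).hom a) :=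
      congr(($(hF.zero)).hom a)
    exact (congrArg (· • (x + (P.Q.X 0).ρ t x)) h3).trans
      ((congrArg (_ + · • (P.Q.X 0).ρ t x) (cocycle_apply_d hg a)).trans
        ((congrArg (_ + ·) (zero_smul k _)).trans (add_zero _))).symm

/-- Induction on the degree of `f`. It is uniform in `j` because each step trades one degree of `f`
for one degree of `g`. -/
lemma exists_isLift_comp_mem_coboundaries (i : ℕ) : ∀ (j : ℕ)
    (f : P.Q.X (i + 1) ⟶ Rep.trivial k G k) (_ : f ∈ P.cocycles (Rep.trivial k G k) (i + 1))
    (g : P.Q.X (j + 1) ⟶ Rep.trivial k G k) (_ : g ∈ P.cocycles (Rep.trivial k G k) (j + 1)),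
    ∃ F, P.IsLift g F ∧ F (i + 1) ≫ f ∈ P.coboundaries (Rep.trivial k G k) (j + 1 + (i + 1)) := by
  obtain ⟨s, t, hs, ht, hst⟩ := exists_generators G
  obtain ⟨y, hy⟩ := (Rep.epi_iff_surjective _).1 P.split_π.1 (1 : k)
  obtain ⟨x, hxy, hx⟩ := invariantLifting_of_isRelSplitEpi P.split_π s hs y rfl
  have hπx : P.π.hom x = (1 : k) := hxy.trans hy
  obtain ⟨ω, W, hW, hω, hW₀⟩ := exists_isShift_comp_eq_zero hs ht hst hx
  -- Reduction from `f` to `W i ≫ f`: split `g` into a coboundary, whose product with `f` is a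
  -- coboundary, and a normalized cocycle, to which the shift applies.
  have step : ∀ i, (∀ (j : ℕ) (f : P.Q.X (i + 1) ⟶ Rep.trivial k G k)
      (_ : f ∈ P.cocycles (Rep.trivial k G k) (i + 1)) (g : P.Q.X (j + 1) ⟶ Rep.trivial k G k)
      (_ : g ∈ P.cocycles (Rep.trivial k G k) (j + 1)), ∃ F, P.IsLift g F ∧
        F i ≫ W i ≫ f ∈ P.coboundaries (Rep.trivial k G k) (j + 1 + i)) →
      ∀ (j : ℕ) (f : P.Q.X (i + 1) ⟶ Rep.trivial k G k)
        (_ : f ∈ P.cocycles (Rep.trivial k G k) (i + 1)) (g : P.Q.X (j + 1) ⟶ Rep.trivial k G k)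
        (_ : g ∈ P.cocycles (Rep.trivial k G k) (j + 1)), ∃ F, P.IsLift g F ∧
          F (i + 1) ≫ f ∈ P.coboundaries (Rep.trivial k G k) (j + 1 + (i + 1)) := by
    intro i hi j f hf g hg
    obtain ⟨e, he⟩ := exists_sub_coboundary_eq_zero hg
    have hB : P.Q.d (j + 1) j ≫ e ∈ P.coboundaries (Rep.trivial k G k) (j + 1) :=
      RelProjResolution.mem_coboundaries.2 ⟨e, rfl⟩
    have hZ : P.Q.d (j + 1) j ≫ e ∈ P.cocycles (Rep.trivial k G k) (j + 1) := by
      rw [RelProjResolution.mem_cocycles, ← Category.assoc, P.Q.d_comp_d, zero_comp]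
    obtain ⟨E, hE⟩ := RelProjResolution.exists_isLift hZ
    obtain ⟨g', hg', F₀, hF₀, h⟩ := exists_shift hs ht hst hx hπx hω (sub_mem hg hZ) he
    obtain ⟨F, hF, hFB⟩ := hi (j + 1) f hf g' hg'
    have hL := isLift_shift hW hF hF₀ (h F hF)
    refine ⟨_, isLift_add hE hL (add_sub_cancel _ g), ?_⟩
    rw [Preadditive.add_comp]
    refine add_mem (RelProjResolution.comp_mem_coboundaries_right hf hB hE) ?_
    have := eqToHom_comp_mem_coboundaries (Nat.succ_add_eq_add_succ (j + 1) i).symm hFB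
    simpa only [Category.assoc] using this
  induction i with
  | zero =>
    refine step 0 fun j f hf g hg => ?_
    obtain ⟨F, hF⟩ := RelProjResolution.exists_isLift hg
    -- The induction starts from the vanishing of `W 0` followed by a 1-cocycle.
    exact ⟨F, hF, by rw [hW₀ f hf, comp_zero]; exact zero_mem _⟩
  | succ i ih =>
    exact step (i + 1) fun j f hf g hg => ih j _ (hW.comp_mem_cocycles hf) g hg

lemma cup_succ_eq_zero (i j : ℕ) (α : P.Ext (Rep.trivial k G k) (i + 1))
    (β : P.Ext (Rep.trivial k G k) (j + 1)) : P.cup (Rep.trivial k G k) (i + 1) (j + 1) α β = 0 := by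
  obtain ⟨f, rfl⟩ := Submodule.Quotient.mk_surjective _ α
  obtain ⟨g, rfl⟩ := Submodule.Quotient.mk_surjective _ β
  obtain ⟨F, hF, h⟩ := exists_isLift_comp_mem_coboundaries i j f.1 f.2 g.1 g.2
  rw [P.cup_mk _ _ _ f g hF]
  exact (Submodule.Quotient.mk_eq_zero _).2 h

end Resolution
end KleinFour

end

theorem theorem2 {k : Type u} [Field k] [CharP k 2] {G : Type v} [Group G] [IsKleinFour G]
    (P : RelProjResolution (properNontrivialSubgroups G) (Rep.trivial k G k))
    (α₁ α₂ : P.ExtStar) (h₁ : α₁ 0 = 0) (h₂ : α₂ 0 = 0) :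
    P.cupStar α₁ α₂ = 0 := by
  classical
  rw [← DirectSum.sum_support_of α₁, ← DirectSum.sum_support_of α₂, map_sum]
  refine Finset.sum_eq_zero fun j _ => ?_
  rw [map_sum, LinearMap.sum_apply]
  refine Finset.sum_eq_zero fun i _ => ?_
  refine (P.cupStar_lof i j (α₁ i) (α₂ j)).trans ?_
  obtain _ | i := i
  · rw [h₁, map_zero, LinearMap.zero_apply, map_zero]
  obtain _ | j := j
  · rw [h₂, map_zero, map_zero]
  · rw [KleinFour.cup_succ_eq_zero, map_zero]
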